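/- Let $k\ge 1$, let $\alpha\in\mathbb{R}$ be such that $\zeta=e^{2\pi i\alpha}$ is a primitive $k$-th root of unity, and write $\zeta^{x}:=e^{2\pi i\alpha x}$ for $x\in\mathbb{R}$, $q:=\zeta e^{-t}$ and $q^{1/8}:=\zeta^{1/8}e^{-t/8}$. Consider the "strange" sums $$H_9(t,\zeta):=-\frac14\sum_{n=0}^{\infty}\frac{(1-q)(1-q^2)\cdots(1-q^n)}{(1+q)(1+q^2)\cdots(1+q^n)},\qquad H_{10}(t,\zeta):=-2q^{1/8}\sum_{n=0}^{\infty}\frac{(1-q^2)(1-q^4)\cdots(1-q^{2n})}{(1-q)(1-q^3)\cdots(1-q^{2n+1})},$$ and the Dirichlet series $$L_1(s,\zeta):=\sum_{n=1}^{\infty}\frac{(-\zeta)^{n^2}}{n^s},\qquad L_2(s,\zeta):=\sum_{n=1}^{\infty}\left(\frac2n\right)^2\frac{\zeta^{n^2/8}}{n^s}\qquad(\operatorname{Re}s>1),$$ where $\left(\frac2n\right)$ is the Kronecker symbol, so that $\left(\frac2n\right)^2$ is $1$ for odd $n$ and $0$ for even $n$. (1) If $k$ is odd, then $L_1(s,\zeta)$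 extends to an entire function of $s$, and, as $t\searrow0$, as power series in $t$, $$H_9(t,\zeta)=\sum_{n=0}^{\infty}\frac{L_1(-2n-1,\zeta)(-t)^n}{n!}.$$ (2) If $k$ is even, then $L_2(s,\zeta)$ extends to an entire function of $s$, and, as $t\searrow0$, as power series in $t$, $$H_{10}(t,\zeta)=\sum_{n=0}^{\infty}\frac{L_2(-2n-1,\zeta)(-t)^n}{8^n\,n!}.$$ The values at $s=-2n-1$ are those of the entire continuations. The sums $H_9,H_{10}$ are not claimed to converge for $t>0$; an identity $\sum_n u_n(t)=\sum_m c_mt^m$ as above means both of the following. (a) If the $u_n$ are expanded as formal power series in $t$, then $\sum_n u_n$ converges $t$-adically in $\mathbb{C}[[t]]$ to $\sum_m c_mt^m$. (b) For every $N\ge0$ and all sufficiently large $M$ (depending on $N$), $\sum_{n<M}u_n(t)-\sum_{m<N}c_mt^m=O(t^N)$ as $t\searrow0$. -/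

import Mathlib

open Filter Topology Asymptotics
open scoped PowerSeries NumberTheorySymbols

noncomputable section

/-- The power `ζ ^ x` of the root of unity `ζ = exp (2 π i α)`, the branch being fixed by `α`:
`ζ ^ x = exp (2 π i α x)`. -/
def zetaPow (α x : ℝ) : ℂ :=
  Complex.exp (2 * Real.pi * Complex.I * α * x)

/-- `ζ e^{-t}` as a function of the real variable `t`. -/
def qFun (α t : ℝ) : ℂ := zetaPow α 1 * Complex.exp (-t)

/-- `(ζ e^{-t}) ^ (1/8)` as a function of the real variable `t`. -/
def qEighthFun (α t : ℝ) : ℂ := zetaPow α (1 / 8) * Complex.exp (-t / 8)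

/-- `ζ e^{-t}` as a formal power series in `t`. -/
def qSer (α : ℝ) : ℂ⟦X⟧ :=
  PowerSeries.C (zetaPow α 1) * PowerSeries.rescale (-1 : ℂ) (PowerSeries.exp ℂ)

/-- `(ζ e^{-t}) ^ (1/8)` as a formal power series in `t`. -/
def qEighthSer (α : ℝ) : ℂ⟦X⟧ :=
  PowerSeries.C (zetaPow α (1 / 8)) * PowerSeries.rescale (-1 / 8 : ℂ) (PowerSeries.exp ℂ)

/-- `(q; q)_n / (-q; q)_n`, used both for complex numbers and for formal power series. -/
def strange9 {R : Type} [CommRing R] [Inv R] (q : R) (n : ℕ) : R :=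
  (∏ j ∈ Finset.range n, (1 - q ^ (j + 1))) * (∏ j ∈ Finset.range n, (1 + q ^ (j + 1)))⁻¹

/-- `r * (q²; q²)_n / (q; q²)_{n+1}`, where `r` stands for `q ^ (1/8)`; used both for complex
numbers and for formal power series. -/
def strange10 {R : Type} [CommRing R] [Inv R] (r q : R) (n : ℕ) : R :=
  r * (∏ j ∈ Finset.range n, (1 - q ^ (2 * (j + 1)))) *
    (∏ j ∈ Finset.range (n + 1), (1 - q ^ (2 * j + 1)))⁻¹

/-- The `n`-th summand of the strange sum `H₉(t, ζ)`, as a function of `t`. -/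
def H9Fun (α : ℝ) (n : ℕ) (t : ℝ) : ℂ := -(1 / 4) * strange9 (qFun α t) n

/-- The `n`-th summand of the strange sum `H₉(t, ζ)`, as a formal power series in `t`. -/
def H9Ser (α : ℝ) (n : ℕ) : ℂ⟦X⟧ := PowerSeries.C (-(1 / 4)) * strange9 (qSer α) n

/-- The `n`-th summand of the strange sum `H₁₀(t, ζ)`, as a function of `t`. -/
def H10Fun (α : ℝ) (n : ℕ) (t : ℝ) : ℂ := -2 * strange10 (qEighthFun α t) (qFun α t) n

/-- The `n`-th summand of the strange sum `H₁₀(t, ζ)`, as a formal power series in `t`. -/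
def H10Ser (α : ℝ) (n : ℕ) : ℂ⟦X⟧ :=
  PowerSeries.C (-2) * strange10 (qEighthSer α) (qSer α) n

/-- The series `∑ u n` of formal power series converges `t`-adically to `∑ c m t ^ m`: each
coefficient of the partial sums is eventually constant, equal to that of the limit. -/
def IsFormalSum (u : ℕ → ℂ⟦X⟧) (c : ℕ → ℂ) : Prop :=
  ∀ m : ℕ, ∀ᶠ M in atTop, PowerSeries.coeff m (∑ n ∈ Finset.range M, u n) = c m

/-- The strange sum `∑ u n t` has the asymptotic power series `∑ c m t ^ m` as `t ↘ 0`. The sum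
need not converge for any `t > 0`; the meaning is that, for each order `N`, all sufficiently long
partial sums agree with the power series up to an error `O(t ^ N)`. -/
def HasStrangeAsymptotics (u : ℕ → ℝ → ℂ) (c : ℕ → ℂ) : Prop :=
  ∀ N : ℕ, ∀ᶠ M in atTop,
    (fun t : ℝ => ∑ n ∈ Finset.range M, u n t - ∑ m ∈ Finset.range N, c m * (t : ℂ) ^ m)
      =O[𝓝[>] (0 : ℝ)] fun t : ℝ => t ^ N

/-- Coefficients of the Dirichlet series `L₁(s, ζ) = ∑_{n ≥ 1} (-ζ) ^ (n²) / n ^ s`. -/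
def coeffL1 (α : ℝ) (n : ℕ) : ℂ := (-zetaPow α 1) ^ (n ^ 2)

/-- Coefficients of the Dirichlet series `L₂(s, ζ) = ∑_{n ≥ 1} (2/n)² ζ ^ (n²/8) / n ^ s`. -/
def coeffL2 (α : ℝ) (n : ℕ) : ℂ := (J(2 | n) : ℂ) ^ 2 * zetaPow α ((n : ℝ) ^ 2 / 8)

/-- `L` is the (necessarily unique) entire continuation of the Dirichlet series
`∑_{n ≥ 1} a n / n ^ s`, which converges for `Re s > 1`. -/
def IsEntireContinuation (a : ℕ → ℂ) (L : ℂ → ℂ) : Prop :=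
  Differentiable ℂ L ∧ ∀ s : ℂ, 1 < s.re → LSeriesHasSum a s (L s)

end

/-! The strange sum is deformed by a variable `x`: `S(x) = ∑ x ^ n (xq; q)_n / (-xq; q)_n`
satisfies, up to a remainder, `(1 - x) S(x) + x² q (1 - xq) S(xq) = 1 - x² q`; the sum behind `H₁₀`
has a similar equation relating `x` and `xq²`. Put `x = ζ ^ i e^{-(w + i) t}`. The remainder
contains a long product in which every `k` consecutive factors include one divisible by `t`, so it
vanishes to high `t`-adic order.

Multiplied by a Gaussian, the equation becomes a telescoping relation `V_i - V_{i+1} = a_i e^{-(i +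
w)² t}`. The coefficients `a` have an antiperiod `K` (`k` for `L₁`, `2k` for `L₂`), and after one
antiperiod `V_0(w)` returns as `-V_0(w + K)`. Hence `V_0(w) + V_0(w + K) = ∑_{n < K} a_n e^{-c (n +
w)² t}` to high order in `t`, with `c = 1` or `1/8`.

Each `t`-coefficient of `V_0` is a polynomial in `w`, and the difference equation has only one
polynomial solution. Bernoulli polynomials, that is, Hurwitz zeta values at negative integers,
supply that solution, and its derivative at `w = 0` is a multiple of `L(-2m-1)`
(`coeff_familyDeriv_eq`). On the other side `1 - x` vanishes at `w = 0` with derivative a constant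
times `t`, so the same derivative is `t` times the strange sum up to known factors. Comparing the
two gives the formal identity.

The asymptotic statement follows: every summand has its formal series as asymptotic expansion, and
only finite partial sums occur (`IsFormalSum.hasStrangeAsymptotics`). -/

/-! ### Antiperiodic Dirichlet series and Bernoulli polynomials -/

theorem periodic_of_antiperiodic {a : ℕ → ℂ} {K : ℕ} (ha : ∀ n, a (n + K) = -a n) :
    Function.Periodic a (2 * K) := fun n => by
  rw [two_mul, ← add_assoc, ha, ha, neg_neg]

theorem apply_natCast_zmod_val {a : ℕ → ℂ} {N : ℕ} (ha : Function.Periodic a N) (n : ℕ) :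
    a ((n : ZMod N).val) = a n := by
  rw [ZMod.val_natCast, ha.map_mod_nat]

theorem sum_zmod_val {M : Type*} [AddCommMonoid M] (N : ℕ) [NeZero N] (f : ℕ → M) :
    ∑ j : ZMod N, f j.val = ∑ n ∈ Finset.range N, f n := by
  refine Finset.sum_bij (fun j _ => j.val) (fun j _ => ?_) (fun i _ j _ h => ?_)
    (fun n hn => ?_) (fun _ _ => rfl)
  · exact Finset.mem_range.2 (ZMod.val_lt j)
  · exact ZMod.val_injective N h
  · exact ⟨n, Finset.mem_univ _, ZMod.val_cast_of_lt (Finset.mem_range.1 hn)⟩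

/-- Summing an antiperiodic function against `f` over two antiperiods. -/
theorem sum_antiperiodic {a : ℕ → ℂ} {K : ℕ} (ha : ∀ n, a (n + K) = -a n) (f : ℕ → ℂ) :
    ∑ n ∈ Finset.range (2 * K), a n * f n =
      ∑ n ∈ Finset.range K, a n * (f n - f (n + K)) := by
  rw [two_mul, Finset.sum_range_add, ← Finset.sum_add_distrib]
  refine Finset.sum_congr rfl fun n _ => ?_
  rw [add_comm K n, ha]
  ring

/-- The entire continuation of the Dirichlet series of an antiperiodic function. -/
theorem isEntireContinuation_LFunction {a : ℕ → ℂ} {K : ℕ} [NeZero (2 * K)]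
    (ha : ∀ n, a (n + K) = -a n) :
    IsEntireContinuation a (ZMod.LFunction fun j : ZMod (2 * K) => a j.val) := by
  -- The only possible pole, at `s = 1`, is absent because the two antiperiods in a period cancel.
  refine ⟨ZMod.differentiable_LFunction_of_sum_zero ?_, fun s hs => ?_⟩
  · rw [sum_zmod_val (2 * K) a]
    simpa using sum_antiperiodic ha fun _ => 1
  · have hfun : (fun n : ℕ => a ((n : ZMod (2 * K)).val)) = a :=
      funext fun n => apply_natCast_zmod_val (periodic_of_antiperiodic ha) n
    have h := (ZMod.LSeriesSummable_of_one_lt_re (fun j : ZMod (2 * K) => a j.val) hs)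
    rw [ZMod.LFunction_eq_LSeries _ hs]
    rw [hfun] at h ⊢
    exact h.LSeriesHasSum

theorem IsEntireContinuation.unique {a : ℕ → ℂ} {L L' : ℂ → ℂ} (h : IsEntireContinuation a L)
    (h' : IsEntireContinuation a L') : L = L' := by
  have hL : AnalyticOnNhd ℂ L Set.univ := fun z _ => h.1.analyticAt z
  have hL' : AnalyticOnNhd ℂ L' Set.univ := fun z _ => h'.1.analyticAt z
  refine hL.eq_of_eventuallyEq hL' (z₀ := 2) ?_
  have hopen : IsOpen {s : ℂ | 1 < s.re} := isOpen_lt continuous_const Complex.continuous_re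
  filter_upwards [hopen.mem_nhds (show (2 : ℂ) ∈ {s : ℂ | 1 < s.re} by simp)] with s hs
  exact (h.2 s hs).LSeries_eq.symm.trans (h'.2 s hs).LSeries_eq

/-- The Bernoulli polynomial with complex coefficients. -/
noncomputable def bernoulliC (n : ℕ) : Polynomial ℂ :=
  (Polynomial.bernoulli n).map (algebraMap ℚ ℂ)

theorem bernoulliC_eval_add_one (n : ℕ) (x : ℂ) :
    (bernoulliC (n + 1)).eval (x + 1) = (bernoulliC (n + 1)).eval x + (n + 1) * x ^ n := by
  have h := congrArg (fun p => (p.map (algebraMap ℚ ℂ)).eval x)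
    (Polynomial.bernoulli_comp_one_add_X (n + 1))
  simp only [Polynomial.map_comp, Polynomial.eval_comp, Polynomial.map_add, Polynomial.map_one,
    Polynomial.map_X, Polynomial.eval_add, Polynomial.eval_one, Polynomial.eval_X,
    add_tsub_cancel_right] at h
  rw [add_comm x 1, bernoulliC, h]
  simp

theorem derivative_bernoulliC (n : ℕ) :
    Polynomial.derivative (bernoulliC (n + 1)) = ((n + 1 : ℕ) : Polynomial ℂ) * bernoulliC n := by
  rw [bernoulliC, Polynomial.derivative_map, Polynomial.derivative_bernoulli_add_one]
  simp [bernoulliC]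

/-- Values at negative integers of the continued Dirichlet series of a periodic function. -/
theorem LFunction_neg_nat_of_periodic (a : ℕ → ℂ) (N : ℕ) [NeZero N] {m : ℕ} (hm : m ≠ 0) :
    ZMod.LFunction (fun j : ZMod N => a j.val) (-m) =
      ∑ n ∈ Finset.range N, a n * (-(N : ℂ) ^ m / (m + 1) * (bernoulliC (m + 1)).eval (n / N : ℂ)) := by
  rw [ZMod.LFunction, neg_neg, Complex.cpow_natCast, ← sum_zmod_val N, Finset.mul_sum]
  refine Finset.sum_congr rfl fun j _ => ?_
  have hx : (j.val / N : ℝ) ∈ Set.Icc (0 : ℝ) 1 := ⟨by positivity,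
    (div_le_one (Nat.cast_pos.mpr <| NeZero.pos _)).mpr <| Nat.cast_le.mpr (ZMod.val_lt j).le⟩
  rw [ZMod.toAddCircle_apply, HurwitzZeta.hurwitzZeta_neg_nat hm hx, bernoulliC]
  push_cast
  ring

/-- Antiperiodicity gives the period `2K`, so the polynomial takes one value infinitely often and is
constant; a constant equal to its own negative is zero. This is the uniqueness of polynomial
solutions of the difference equation. -/
theorem polynomial_eq_zero_of_antiperiodic {K : ℕ} (hK : 0 < K) {d : Polynomial ℂ}
    (hd : ∀ w : ℂ, d.eval w + d.eval (w + K) = 0) : d = 0 := by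
  have hper : ∀ j : ℕ, d.eval ((2 * K * j : ℕ) : ℂ) = d.eval 0 := by
    intro j
    induction j with
    | zero => simp
    | succ j ih =>
      rw [← ih]
      have h1 := hd ((2 * K * j : ℕ) : ℂ)
      have h2 := hd ((2 * K * j : ℕ) + K : ℂ)
      rw [show ((2 * K * (j + 1) : ℕ) : ℂ) = (2 * K * j : ℕ) + K + K by push_cast; ring]
      linear_combination h2 - h1
  have hconst : d = Polynomial.C (d.eval 0) := by
    refine Polynomial.eq_of_infinite_eval_eq _ _ ?_
    refine (Set.infinite_range_of_injective (f := fun j : ℕ => ((2 * K * j : ℕ) : ℂ)) ?_).mono ?_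
    · intro i j hij
      have : 2 * K * i = 2 * K * j := by
        simpa only [Nat.cast_inj] using hij
      exact Nat.eq_of_mul_eq_mul_left (by positivity) this
    · rintro _ ⟨j, rfl⟩
      simp only [Set.mem_ofPred_eq, Polynomial.eval_C]
      exact hper j
  have h0 := hd 0
  rw [hconst] at h0
  simp only [Polynomial.eval_C] at h0
  rw [hconst, show d.eval 0 = 0 by linear_combination h0 / 2, Polynomial.C_0]

/-- The polynomial `∑_{n ≥ 0} a n (n + w) ^ N`, summed by Abel's method, for a function `a` with
antiperiod `K`. -/
noncomputable def abelSumPoly (a : ℕ → ℂ) (K N : ℕ) : Polynomial ℂ :=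
  ∑ n ∈ Finset.range (2 * K), Polynomial.C (a n * (-((2 * K : ℕ) : ℂ) ^ N / (N + 1))) *
    (bernoulliC (N + 1)).comp (Polynomial.C (((2 * K : ℕ) : ℂ)⁻¹) * (Polynomial.X + Polynomial.C (n : ℂ)))

theorem abelSumPoly_eval (a : ℕ → ℂ) (K N : ℕ) (w : ℂ) :
    (abelSumPoly a K N).eval w = ∑ n ∈ Finset.range (2 * K), a n *
      (-((2 * K : ℕ) : ℂ) ^ N / (N + 1) * (bernoulliC (N + 1)).eval ((n + w) / (2 * K : ℕ))) := by
  rw [abelSumPoly, Polynomial.eval_finsetSum]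
  refine Finset.sum_congr rfl fun n _ => ?_
  simp only [Polynomial.eval_mul, Polynomial.eval_C, Polynomial.eval_comp, Polynomial.eval_add,
    Polynomial.eval_X]
  rw [mul_assoc, div_eq_inv_mul (_ + w), add_comm w]

/-- After folding by antiperiodicity, the terms at `n + K + w` and `n + (w + K)` cancel. What
remains for each `n` is a difference of Bernoulli values at arguments one apart, which is a pure
power. -/
theorem abelSumPoly_add_shift {a : ℕ → ℂ} {K : ℕ} (hK : 0 < K) (ha : ∀ n, a (n + K) = -a n)
    (N : ℕ) (w : ℂ) :
    (abelSumPoly a K N).eval w + (abelSumPoly a K N).eval (w + K) =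
      ∑ n ∈ Finset.range K, a n * (n + w) ^ N := by
  rw [abelSumPoly_eval, abelSumPoly_eval, sum_antiperiodic ha, sum_antiperiodic ha,
    ← Finset.sum_add_distrib]
  refine Finset.sum_congr rfl fun n _ => ?_
  have hK' : ((2 * K : ℕ) : ℂ) ≠ 0 := by exact_mod_cast (by positivity : 2 * K ≠ 0)
  have hN : (N + 1 : ℂ) ≠ 0 := by exact_mod_cast N.succ_ne_zero
  have h := bernoulliC_eval_add_one N ((n + w) / (2 * K : ℕ))
  have e1 : ((n + K : ℕ) + w : ℂ) = n + (w + K) := by push_cast; ring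
  have e2 : ((n + K : ℕ) + (w + K) : ℂ) / (2 * K : ℕ) = (n + w) / (2 * K : ℕ) + 1 := by
    rw [div_add_one hK']
    push_cast
    ring
  rw [e1, e2, h, div_pow]
  field_simp
  ring

/-- The Bernoulli polynomials form an Appell sequence, so differentiating in `w` lowers the exponent
just as it does for `(n + w) ^ (N + 1)`. -/
theorem derivative_abelSumPoly {a : ℕ → ℂ} {K : ℕ} (hK : 0 < K) (N : ℕ) :
    (Polynomial.derivative (abelSumPoly a K (N + 1))).eval 0 =
      (N + 1) * (abelSumPoly a K N).eval 0 := by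
  have hN : (N + 1 : ℂ) ≠ 0 := by exact_mod_cast N.succ_ne_zero
  have hN' : (N + 1 + 1 : ℂ) ≠ 0 := by exact_mod_cast (N + 1).succ_ne_zero
  rw [abelSumPoly_eval, abelSumPoly, Polynomial.derivative_sum, Polynomial.eval_finsetSum,
    Finset.mul_sum]
  refine Finset.sum_congr rfl fun n _ => ?_
  rw [Polynomial.derivative_C_mul, Polynomial.derivative_comp, derivative_bernoulliC]
  simp only [Polynomial.derivative_C_mul, Polynomial.derivative_add, Polynomial.derivative_X,
    Polynomial.derivative_C, Polynomial.eval_mul, Polynomial.eval_C, Polynomial.eval_comp,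
    Polynomial.eval_add, Polynomial.eval_X, Polynomial.eval_natCast,
    add_zero, zero_add, mul_one]
  rw [div_eq_inv_mul (n : ℂ), pow_succ]
  have hK0 : (K : ℂ) ≠ 0 := by exact_mod_cast hK.ne'
  push_cast
  field_simp

/-- The polynomial solution `p` of `p(w) + p(w + K) = ∑_{n < K} a n (n + w) ^ (N + 1)` has
`p'(0) = (N + 1) L(-N)`. -/
theorem derivative_eval_zero_of_antiperiodic {a : ℕ → ℂ} {K : ℕ} (hK : 0 < K)
    (ha : ∀ n, a (n + K) = -a n) {L : ℂ → ℂ} (hL : IsEntireContinuation a L) {N : ℕ} (hN : N ≠ 0)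
    {c : ℂ} {p : Polynomial ℂ}
    (hp : ∀ w : ℂ, p.eval w + p.eval (w + K) =
      c * ∑ n ∈ Finset.range K, a n * (n + w) ^ (N + 1)) :
    (Polynomial.derivative p).eval 0 = c * ((N + 1) * L (-N)) := by
  have : NeZero (2 * K) := ⟨by positivity⟩
  -- Both polynomials solve the same difference equation, so uniqueness identifies them.
  have hpP : p - Polynomial.C c * abelSumPoly a K (N + 1) = 0 := by
    refine polynomial_eq_zero_of_antiperiodic hK fun w => ?_
    simp only [Polynomial.eval_sub, Polynomial.eval_mul, Polynomial.eval_C]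
    linear_combination hp w - c * abelSumPoly_add_shift hK ha (N + 1) w
  rw [sub_eq_zero.1 hpP, Polynomial.derivative_C_mul, Polynomial.eval_mul, Polynomial.eval_C,
    derivative_abelSumPoly hK, abelSumPoly_eval, hL.unique (isEntireContinuation_LFunction ha),
    LFunction_neg_nat_of_periodic a (2 * K) hN]
  simp

/-! ### Families of formal power series in a parameter -/

/-- The formal power series `e ^ (a t)`. -/
noncomputable def expSer (a : ℂ) : ℂ⟦X⟧ := PowerSeries.rescale a (PowerSeries.exp ℂ)

theorem coeff_expSer (a : ℂ) (n : ℕ) :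
    PowerSeries.coeff n (expSer a) = a ^ n / (n.factorial : ℂ) := by
  simp [expSer, PowerSeries.coeff_rescale, div_eq_mul_inv]

theorem constantCoeff_expSer (a : ℂ) : PowerSeries.constantCoeff (expSer a) = 1 := by
  rw [← PowerSeries.coeff_zero_eq_constantCoeff_apply, coeff_expSer]
  simp

theorem expSer_mul (a b : ℂ) : expSer a * expSer b = expSer (a + b) :=
  PowerSeries.exp_mul_exp_eq_exp_add a b

theorem expSer_zero : expSer 0 = 1 := by
  ext n
  rw [coeff_expSer, PowerSeries.coeff_one]
  split_ifs with h <;> simp [h]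

theorem expSer_pow (a : ℂ) (n : ℕ) : expSer a ^ n = expSer (n * a) := by
  induction n with
  | zero => simp [expSer_zero]
  | succ n ih =>
    rw [pow_succ, ih, expSer_mul]
    congr 1
    push_cast
    ring

/-- A family of formal power series whose coefficients are polynomials in the parameter. -/
def IsPolyFamily (F : ℂ → ℂ⟦X⟧) : Prop :=
  ∀ m, ∃ p : Polynomial ℂ, ∀ w, PowerSeries.coeff m (F w) = p.eval w

namespace IsPolyFamily

theorem const (F : ℂ⟦X⟧) : IsPolyFamily fun _ => F := fun m =>
  ⟨Polynomial.C (PowerSeries.coeff m F), fun w => by simp⟩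

theorem expSer (p : Polynomial ℂ) : IsPolyFamily fun w => expSer (p.eval w) := fun m =>
  ⟨p ^ m * Polynomial.C ((m.factorial : ℂ)⁻¹), fun w => by
    simp [coeff_expSer, div_eq_mul_inv]⟩

theorem add {F G : ℂ → ℂ⟦X⟧} (hF : IsPolyFamily F) (hG : IsPolyFamily G) :
    IsPolyFamily fun w => F w + G w := fun m => by
  obtain ⟨p, hp⟩ := hF m
  obtain ⟨r, hr⟩ := hG m
  exact ⟨p + r, fun w => by simp [hp, hr]⟩

theorem sub {F G : ℂ → ℂ⟦X⟧} (hF : IsPolyFamily F) (hG : IsPolyFamily G) :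
    IsPolyFamily fun w => F w - G w := fun m => by
  obtain ⟨p, hp⟩ := hF m
  obtain ⟨r, hr⟩ := hG m
  exact ⟨p - r, fun w => by simp [hp, hr]⟩

theorem mul {F G : ℂ → ℂ⟦X⟧} (hF : IsPolyFamily F) (hG : IsPolyFamily G) :
    IsPolyFamily fun w => F w * G w := fun m => by
  choose p hp using hF
  choose r hr using hG
  refine ⟨∑ x ∈ Finset.HasAntidiagonal.antidiagonal m, p x.1 * r x.2, fun w => ?_⟩
  simp [PowerSeries.coeff_mul, Polynomial.eval_finsetSum, hp, hr]

theorem pow {F : ℂ → ℂ⟦X⟧} (hF : IsPolyFamily F) (n : ℕ) : IsPolyFamily fun w => F w ^ n := by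
  induction n with
  | zero => simpa using const 1
  | succ n ih => simpa only [pow_succ] using ih.mul hF

theorem sum {ι : Type*} (s : Finset ι) {F : ι → ℂ → ℂ⟦X⟧} (hF : ∀ i, IsPolyFamily (F i)) :
    IsPolyFamily fun w => ∑ i ∈ s, F i w := by
  classical
  induction s using Finset.induction_on with
  | empty => simpa using const 0
  | insert i s hi ih => simpa only [Finset.sum_insert hi] using (hF i).add ih

theorem prod {ι : Type*} (s : Finset ι) {F : ι → ℂ → ℂ⟦X⟧} (hF : ∀ i, IsPolyFamily (F i)) :
    IsPolyFamily fun w => ∏ i ∈ s, F i w := by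
  classical
  induction s using Finset.induction_on with
  | empty => simpa using const 1
  | insert i s hi ih => simpa only [Finset.prod_insert hi] using (hF i).mul ih

/-- The recursion for the coefficients of an inverse divides only by the constant coefficient. Since
that does not depend on the parameter, polynomiality is preserved. -/
theorem inv {F : ℂ → ℂ⟦X⟧} (hF : IsPolyFamily F) {c : ℂ}
    (hc : ∀ w, PowerSeries.constantCoeff (F w) = c) : IsPolyFamily fun w => (F w)⁻¹ := by
  intro m
  induction m using Nat.strong_induction_on with
  | _ m ih =>
    rcases eq_or_ne m 0 with rfl | hm
    · exact ⟨Polynomial.C c⁻¹, fun w => by simp [hc]⟩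
    choose p hp using hF
    choose! r hr using ih
    refine ⟨Polynomial.C (-c⁻¹) * ∑ x ∈ Finset.HasAntidiagonal.antidiagonal m,
      if x.2 < m then p x.1 * r x.2 else 0, fun w => ?_⟩
    rw [PowerSeries.coeff_inv, if_neg hm, hc, Polynomial.eval_mul, Polynomial.eval_C,
      Polynomial.eval_finsetSum]
    congr 1
    refine Finset.sum_congr rfl fun x _ => ?_
    split_ifs with hx
    · rw [hp, hr _ hx, Polynomial.eval_mul]
    · simp

end IsPolyFamily

/-- The family `F` of formal power series has the coefficientwise derivative `F'` at the parameter
value `0`. -/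
def HasFamilyDeriv (F : ℂ → ℂ⟦X⟧) (F' : ℂ⟦X⟧) : Prop :=
  ∀ m, HasDerivAt (fun w => PowerSeries.coeff m (F w)) (PowerSeries.coeff m F') 0

/-- Only existence matters: where this is used for a partial sum, its derivative is multiplied by a
factor vanishing at `w = 0`. -/
theorem IsPolyFamily.exists_hasFamilyDeriv {F : ℂ → ℂ⟦X⟧} (hF : IsPolyFamily F) :
    ∃ F', HasFamilyDeriv F F' := by
  choose p hp using hF
  refine ⟨PowerSeries.mk fun m => (Polynomial.derivative (p m)).eval 0, fun m => ?_⟩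
  rw [funext (hp m), PowerSeries.coeff_mk]
  exact (p m).hasDerivAt 0

namespace HasFamilyDeriv

theorem const (F : ℂ⟦X⟧) : HasFamilyDeriv (fun _ => F) 0 := fun m => by
  simpa using hasDerivAt_const (0 : ℂ) (PowerSeries.coeff m F)

theorem expSer {f : ℂ → ℂ} {f' : ℂ} (hf : HasDerivAt f f' 0) :
    HasFamilyDeriv (fun w => expSer (f w)) (PowerSeries.C f' * PowerSeries.X * expSer (f 0)) := by
  intro m
  simp only [coeff_expSer]
  convert! (hf.fun_pow m).div_const (m.factorial : ℂ) using 1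
  rw [mul_assoc, PowerSeries.coeff_C_mul]
  rcases m with _ | m
  · simp
  · rw [PowerSeries.coeff_succ_X_mul, coeff_expSer, Nat.factorial_succ]
    have h1 : (m.factorial : ℂ) ≠ 0 := by exact_mod_cast m.factorial_ne_zero
    have h2 : (m + 1 : ℂ) ≠ 0 := by exact_mod_cast m.succ_ne_zero
    push_cast
    field_simp

theorem add {F G : ℂ → ℂ⟦X⟧} {F' G' : ℂ⟦X⟧} (hF : HasFamilyDeriv F F')
    (hG : HasFamilyDeriv G G') : HasFamilyDeriv (fun w => F w + G w) (F' + G') := fun m => by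
  simpa only [map_add] using (hF m).fun_add (hG m)

theorem sub {F G : ℂ → ℂ⟦X⟧} {F' G' : ℂ⟦X⟧} (hF : HasFamilyDeriv F F')
    (hG : HasFamilyDeriv G G') : HasFamilyDeriv (fun w => F w - G w) (F' - G') := fun m => by
  simpa only [map_sub] using (hF m).fun_sub (hG m)

theorem mul {F G : ℂ → ℂ⟦X⟧} {F' G' : ℂ⟦X⟧} (hF : HasFamilyDeriv F F')
    (hG : HasFamilyDeriv G G') :
    HasFamilyDeriv (fun w => F w * G w) (F' * G 0 + F 0 * G') := fun m => by
  simp only [map_add, PowerSeries.coeff_mul, ← Finset.sum_add_distrib]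
  exact HasDerivAt.fun_sum fun x _ => (hF x.1).fun_mul (hG x.2)

end HasFamilyDeriv

/-- If the coefficient of `t ^ m` in `V w + V (w + K)` is that of `∑_{n < K} a n e^{-c (n + w)² t}`,
then the derivative of the coefficient of `t ^ m` in `V` is an `L`-value. -/
theorem coeff_familyDeriv_eq {a : ℕ → ℂ} {K : ℕ} (hK : 0 < K) (ha : ∀ n, a (n + K) = -a n)
    {L : ℂ → ℂ} (hL : IsEntireContinuation a L) {V : ℂ → ℂ⟦X⟧} {V' : ℂ⟦X⟧} {c : ℂ} {m : ℕ}
    (hV : IsPolyFamily V) (hV' : HasFamilyDeriv V V')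
    (h : ∀ w, PowerSeries.coeff (m + 1) (V w) + PowerSeries.coeff (m + 1) (V (w + K)) =
      PowerSeries.coeff (m + 1)
        (∑ n ∈ Finset.range K, PowerSeries.C (a n) * expSer (-c * (n + w) ^ 2))) :
    PowerSeries.coeff (m + 1) V' =
      2 * (-c) ^ (m + 1) / (m.factorial : ℂ) * L (-2 * (m : ℂ) - 1) := by
  obtain ⟨p, hp⟩ := hV (m + 1)
  have hder := hV' (m + 1)
  rw [funext hp] at hder
  -- The coefficient of `t ^ (m + 1)` in the Gaussian has degree `2m + 2` in `n + w`, so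
  -- differentiation leaves exponent `N = 2m + 1`.
  rw [hder.unique (p.hasDerivAt 0), derivative_eval_zero_of_antiperiodic hK ha hL
    (N := 2 * m + 1) (c := (-c) ^ (m + 1) / ((m + 1).factorial : ℂ)) (by positivity)]
  · have h1 : (m.factorial : ℂ) ≠ 0 := by exact_mod_cast m.factorial_ne_zero
    have h2 : (m + 1 : ℂ) ≠ 0 := by exact_mod_cast m.succ_ne_zero
    rw [Nat.factorial_succ, show -((2 * m + 1 : ℕ) : ℂ) = -2 * m - 1 by push_cast; ring]
    push_cast
    field_simp
    ring
  · intro w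
    rw [← hp, ← hp, h, map_sum, Finset.mul_sum]
    refine Finset.sum_congr rfl fun n _ => ?_
    rw [PowerSeries.coeff_C_mul, coeff_expSer, mul_pow, ← pow_mul]
    ring

/-! ### Asymptotic expansions as `t ↘ 0` -/

/-- The function `f` has the asymptotic expansion `F` as `t ↘ 0`. -/
def HasExpansion (f : ℝ → ℂ) (F : ℂ⟦X⟧) : Prop :=
  ∀ N : ℕ, (fun t : ℝ => f t - (PowerSeries.trunc N F).eval (t : ℂ)) =O[𝓝[>] (0 : ℝ)]
    fun t : ℝ => t ^ N

theorem eval_trunc (N : ℕ) (F : ℂ⟦X⟧) (z : ℂ) :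
    (PowerSeries.trunc N F).eval z = ∑ m ∈ Finset.range N, PowerSeries.coeff m F * z ^ m := by
  rw [Polynomial.eval, PowerSeries.eval₂_trunc_eq_sum_range]
  rfl

theorem isBigO_one_ofReal_of_continuous {f : ℂ → ℂ} (hf : Continuous f) :
    (fun t : ℝ => f t) =O[𝓝[>] (0 : ℝ)] fun _ => (1 : ℝ) := by
  have h : Continuous fun t : ℝ => f t := by fun_prop
  exact (h.continuousAt.tendsto.mono_left nhdsWithin_le_nhds).isBigO_one ℝ

theorem isBigO_eval_of_trunc_eq {p r : Polynomial ℂ} {N : ℕ}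
    (h : ∀ i < N, p.coeff i = r.coeff i) :
    (fun t : ℝ => p.eval (t : ℂ) - r.eval (t : ℂ)) =O[𝓝[>] (0 : ℝ)] fun t : ℝ => t ^ N := by
  obtain ⟨s, hs⟩ : Polynomial.X ^ N ∣ p - r :=
    Polynomial.X_pow_dvd_iff.2 fun i hi => by rw [Polynomial.coeff_sub, h i hi, sub_self]
  have h1 : (fun t : ℝ => p.eval (t : ℂ) - r.eval (t : ℂ)) = fun t : ℝ => (t : ℂ) ^ N * s.eval (t : ℂ) := by
    funext t
    rw [← Polynomial.eval_sub, hs]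
    simp
  rw [h1]
  have h2 : (fun t : ℝ => (t : ℂ) ^ N) =O[𝓝[>] (0 : ℝ)] fun t : ℝ => t ^ N :=
    isBigO_of_le _ fun t => by simp
  simpa using h2.mul (isBigO_one_ofReal_of_continuous s.continuous)

namespace HasExpansion

variable {f g : ℝ → ℂ} {F G : ℂ⟦X⟧}

theorem tendsto (hf : HasExpansion f F) :
    Tendsto f (𝓝[>] 0) (𝓝 (PowerSeries.constantCoeff F)) := by
  have h := hf 1
  have h0 : Tendsto (fun t : ℝ => t ^ 1) (𝓝[>] 0) (𝓝 0) := by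
    have : Continuous fun t : ℝ => t ^ 1 := by fun_prop
    simpa using (this.tendsto 0).mono_left nhdsWithin_le_nhds
  have h1 := (h.trans_tendsto h0).add_const (PowerSeries.constantCoeff F)
  simpa [PowerSeries.trunc_one_left] using h1

theorem isBigO_one (hf : HasExpansion f F) : f =O[𝓝[>] (0 : ℝ)] fun _ => (1 : ℝ) :=
  hf.tendsto.isBigO_one ℝ

theorem polynomial (p : Polynomial ℂ) : HasExpansion (fun t => p.eval (t : ℂ)) (p : ℂ⟦X⟧) :=
  fun N => isBigO_eval_of_trunc_eq fun i hi => by simp [PowerSeries.coeff_trunc, hi]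

theorem const (c : ℂ) : HasExpansion (fun _ => c) (PowerSeries.C c) := by
  simpa using polynomial (Polynomial.C c)

theorem one : HasExpansion (fun _ => 1) 1 := by
  simpa using const 1

theorem exp (a : ℂ) : HasExpansion (fun t => Complex.exp (a * t)) (expSer a) := by
  intro N
  have h1 : ∀ t : ℝ, (PowerSeries.trunc N (expSer a)).eval (t : ℂ) =
      ∑ m ∈ Finset.range N, (a * t) ^ m / (m.factorial : ℂ) := fun t => by
    rw [eval_trunc]
    refine Finset.sum_congr rfl fun m _ => ?_
    rw [coeff_expSer, mul_pow]
    ring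
  simp only [h1]
  have h2 : (fun t : ℝ => Complex.exp (a * t) - ∑ m ∈ Finset.range N, (a * t) ^ m / (m.factorial : ℂ))
      =O[𝓝[>] (0 : ℝ)] fun t : ℝ => (a * t) ^ N * (Real.exp ‖a * t‖ : ℂ) :=
    isBigO_of_le _ fun t => by
      refine (Complex.norm_exp_sub_sum_le_norm_mul_exp _ N).trans_eq ?_
      rw [norm_mul ((a * t) ^ N), norm_pow, Complex.norm_real, Real.norm_of_nonneg (Real.exp_nonneg _)]
  refine h2.trans ?_
  have h3 : (fun t : ℝ => (t : ℂ) ^ N) =O[𝓝[>] (0 : ℝ)] fun t : ℝ => t ^ N :=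
    isBigO_of_le _ fun t => by simp
  have h4 := h3.mul (isBigO_one_ofReal_of_continuous
    (f := fun t : ℂ => a ^ N * (Real.exp ‖a * t‖ : ℂ)) (by fun_prop))
  simp only [mul_one] at h4
  refine h4.congr_left fun t => ?_
  ring

theorem add (hf : HasExpansion f F) (hg : HasExpansion g G) :
    HasExpansion (fun t => f t + g t) (F + G) := fun N => by
  refine ((hf N).add (hg N)).congr_left fun t => ?_
  rw [map_add, Polynomial.eval_add]
  ring

theorem sub (hf : HasExpansion f F) (hg : HasExpansion g G) :
    HasExpansion (fun t => f t - g t) (F - G) := fun N => by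
  refine ((hf N).sub (hg N)).congr_left fun t => ?_
  rw [map_sub, Polynomial.eval_sub]
  ring

theorem mul (hf : HasExpansion f F) (hg : HasExpansion g G) :
    HasExpansion (fun t => f t * g t) (F * G) := fun N => by
  set FN := PowerSeries.trunc N F
  set GN := PowerSeries.trunc N G
  have h1 := hf.isBigO_one.mul (hg N)
  have h2 := (hf N).mul (isBigO_one_ofReal_of_continuous GN.continuous)
  have h3 : (fun t : ℝ => (FN * GN).eval (t : ℂ) - (PowerSeries.trunc N (F * G)).eval (t : ℂ))
      =O[𝓝[>] (0 : ℝ)] fun t : ℝ => t ^ N := by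
    refine isBigO_eval_of_trunc_eq fun i hi => ?_
    rw [← PowerSeries.trunc_trunc_mul_trunc, PowerSeries.coeff_trunc, if_pos hi,
      ← Polynomial.coe_mul, Polynomial.coeff_coe]
  simp only [one_mul] at h1
  simp only [mul_one] at h2
  refine ((h1.add h2).add h3).congr_left fun t => ?_
  rw [Polynomial.eval_mul]
  ring

theorem pow (hf : HasExpansion f F) (n : ℕ) : HasExpansion (fun t => f t ^ n) (F ^ n) := by
  induction n with
  | zero => simpa using one
  | succ n ih => simpa only [pow_succ] using ih.mul hf

theorem sum {ι : Type*} (s : Finset ι) {f : ι → ℝ → ℂ} {F : ι → ℂ⟦X⟧}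
    (h : ∀ i, HasExpansion (f i) (F i)) :
    HasExpansion (fun t => ∑ i ∈ s, f i t) (∑ i ∈ s, F i) := by
  classical
  induction s using Finset.induction_on with
  | empty => simpa using const 0
  | insert i s hi ih => simpa only [Finset.sum_insert hi] using (h i).add ih

theorem prod {ι : Type*} (s : Finset ι) {f : ι → ℝ → ℂ} {F : ι → ℂ⟦X⟧}
    (h : ∀ i, HasExpansion (f i) (F i)) :
    HasExpansion (fun t => ∏ i ∈ s, f i t) (∏ i ∈ s, F i) := by
  classical
  induction s using Finset.induction_on with
  | empty => simpa using one
  | insert i s hi ih => simpa only [Finset.prod_insert hi] using (h i).mul ih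

/-- If `r` truncates `F⁻¹` at order `N`, then `f r = 1 + O(t ^ N)`; multiplying by `f⁻¹`, which
stays bounded near `0`, gives `f⁻¹ - r = O(t ^ N)`. -/
theorem inv (hf : HasExpansion f F) (h0 : PowerSeries.constantCoeff F ≠ 0) :
    HasExpansion (fun t => (f t)⁻¹) F⁻¹ := fun N => by
  set r := PowerSeries.trunc N F⁻¹
  have h1 := (hf.mul (polynomial r)) N
  have h2 : PowerSeries.trunc N (F * (r : ℂ⟦X⟧)) = PowerSeries.trunc N 1 := by
    rw [PowerSeries.trunc_mul_trunc, PowerSeries.mul_inv_cancel _ h0]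
  have h3 := one N
  rw [← h2] at h3
  have h4 : (fun t => (f t)⁻¹) =O[𝓝[>] (0 : ℝ)] fun _ => (1 : ℝ) :=
    (hf.tendsto.inv₀ h0).isBigO_one ℝ
  have h5 := h4.mul (h3.sub h1)
  simp only [one_mul] at h5
  refine h5.congr' ?_ EventuallyEq.rfl
  filter_upwards [hf.tendsto.eventually_ne h0] with t ht
  field_simp
  ring

end HasExpansion

/-- A strange sum with summands expanding into power series, and whose formal sum is known, has
the corresponding asymptotics. -/
theorem IsFormalSum.hasStrangeAsymptotics {u : ℕ → ℝ → ℂ} {U : ℕ → ℂ⟦X⟧} {c : ℕ → ℂ}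
    (hU : IsFormalSum U c) (hu : ∀ n, HasExpansion (u n) (U n)) :
    HasStrangeAsymptotics u c := fun N => by
  have h : ∀ᶠ M in atTop, ∀ m ∈ Finset.range N,
      PowerSeries.coeff m (∑ n ∈ Finset.range M, U n) = c m :=
    (Filter.eventually_all_finset _).2 fun m _ => hU m
  filter_upwards [h] with M hM
  refine (HasExpansion.sum (Finset.range M) hu N).congr_left fun t => ?_
  rw [eval_trunc]
  refine congrArg _ (Finset.sum_congr rfl fun m hm => ?_)
  rw [hM m hm]

/-! ### Functional equations of the partial sums -/

section Telescoping

variable {R : Type*} [CommRing R]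

/-- The partial sum `∑_{n < M} x ^ n (xq; q)_n / (-xq; q)_n`, where `d j` stands for the inverse of
`1 + x q ^ (j + 1)`. -/
def partialSum9 (x q : R) (d : ℕ → R) (M : ℕ) : R :=
  ∑ n ∈ Finset.range M,
    x ^ n * (∏ j ∈ Finset.range n, (1 - x * q ^ (j + 1))) * ∏ j ∈ Finset.range n, d j

/-- The partial sum `∑_{n < M} x ^ n (xq²; q²)_n / (xq; q²)_{n + 1}`, where `d j` stands for the
inverse of `1 - x q ^ (2 j + 1)`. -/
def partialSum10 (x q : R) (d : ℕ → R) (M : ℕ) : R :=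
  ∑ n ∈ Finset.range M,
    x ^ n * (∏ j ∈ Finset.range n, (1 - x * q ^ (2 * (j + 1)))) * ∏ j ∈ Finset.range (n + 1), d j

/-- The prefactor `1 - xq` turns the shifted numerator into a longer unshifted one, and the shifted
denominators are the old ones without their first factor. The `M`-th terms on the left therefore
combine into the difference of consecutive remainders. Keeping the remainder explicit makes the
identity exact for finite `M` in any commutative ring. -/
theorem partialSum9_add_shift (x q : R) (d : ℕ → R) (hd : ∀ j, (1 + x * q ^ (j + 1)) * d j = 1)
    (M : ℕ) :
    (1 - x) * partialSum9 x q d M +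
        x ^ 2 * q * ((1 - x * q) * partialSum9 (x * q) q (fun j => d (j + 1)) M) =
      1 - x ^ 2 * q - (∏ j ∈ Finset.range M, (1 - x * q ^ (j + 1))) *
        (x ^ M * (∏ j ∈ Finset.range M, d j) * (1 - x ^ 2 * q ^ (M + 1))) := by
  have hA : ∀ n, (1 - x * q) * ∏ j ∈ Finset.range n, (1 - x * q * q ^ (j + 1)) =
      ∏ j ∈ Finset.range (n + 1), (1 - x * q ^ (j + 1)) := fun n => by
    rw [Finset.prod_range_succ', mul_comm]
    congr 1
    · exact Finset.prod_congr rfl fun j _ => by ring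
    · ring
  have hD : ∀ n, ∏ j ∈ Finset.range n, d (j + 1) =
      (1 + x * q) * ∏ j ∈ Finset.range (n + 1), d j := fun n => by
    rw [Finset.prod_range_succ']
    linear_combination -(∏ j ∈ Finset.range n, d (j + 1)) * hd 0
  induction M with
  | zero => simp [partialSum9]
  | succ M ih =>
    rw [partialSum9, partialSum9, Finset.sum_range_succ, Finset.sum_range_succ, ← partialSum9,
      ← partialSum9, hD]
    have hA' := hA M
    rw [Finset.prod_range_succ] at hA'
    simp only [Finset.prod_range_succ _ M]
    set A := ∏ j ∈ Finset.range M, (1 - x * q ^ (j + 1))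
    set B := ∏ j ∈ Finset.range M, (1 - x * q * q ^ (j + 1))
    set D := ∏ j ∈ Finset.range M, d j
    linear_combination ih + x ^ 2 * q * (x * q) ^ M * (1 + x * q) * D * d M * hA' +
      (-(x ^ M * A * D * (1 - x))  + x ^ M * A * D * (1 - x ^ 2 * q ^ (M + 1))) * hd M

/-- Same mechanism with the shift `x ↦ xq²`, which preserves the parity of the exponents of `q`. -/
theorem partialSum10_sub_shift (x q : R) (d : ℕ → R)
    (hd : ∀ j, (1 - x * q ^ (2 * j + 1)) * d j = 1) (M : ℕ) :
    (1 - x) * partialSum10 x q d M -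
        x ^ 2 * q ^ 3 * ((1 - x * q ^ 2) * partialSum10 (x * q ^ 2) q (fun j => d (j + 1)) M) =
      1 + x * q - (∏ j ∈ Finset.range M, (1 - x * q ^ (2 * (j + 1)))) *
        (x ^ M * (∏ j ∈ Finset.range (M + 1), d j) * (1 - x ^ 2 * q ^ (2 * M + 2))) := by
  have hA : ∀ n, (1 - x * q ^ 2) * ∏ j ∈ Finset.range n, (1 - x * q ^ 2 * q ^ (2 * (j + 1))) =
      ∏ j ∈ Finset.range (n + 1), (1 - x * q ^ (2 * (j + 1))) := fun n => by
    rw [Finset.prod_range_succ', mul_comm]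
    congr 1
    exact Finset.prod_congr rfl fun j _ => by ring
  have hD : ∀ n, ∏ j ∈ Finset.range n, d (j + 1) =
      (1 - x * q) * ∏ j ∈ Finset.range (n + 1), d j := fun n => by
    rw [Finset.prod_range_succ']
    linear_combination -(∏ j ∈ Finset.range n, d (j + 1)) * hd 0
  induction M with
  | zero =>
    simp [partialSum10]
    linear_combination (1 + x * q) * hd 0
  | succ M ih =>
    rw [partialSum10, partialSum10, Finset.sum_range_succ, Finset.sum_range_succ, ← partialSum10,
      ← partialSum10, hD]
    have hA' := hA M
    rw [Finset.prod_range_succ] at hA'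
    simp only [Finset.prod_range_succ _ (M + 1), Finset.prod_range_succ (fun j => 1 - x * q ^ (2 * (j + 1))) M]
    set A := ∏ j ∈ Finset.range M, (1 - x * q ^ (2 * (j + 1)))
    set B := ∏ j ∈ Finset.range M, (1 - x * q ^ 2 * q ^ (2 * (j + 1)))
    set D := ∏ j ∈ Finset.range (M + 1), d j
    linear_combination ih - x ^ 2 * q ^ 3 * (x * q ^ 2) ^ M * (1 - x * q) * D * d (M + 1) * hA' +
      (-(x ^ M * A * D * (1 - x))  + x ^ M * A * D * (1 - x ^ 2 * q ^ (2 * M + 2))) * hd (M + 1)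

end Telescoping

/-! ### Divisibility of long products by powers of `t` -/

theorem powerSeries_prod_inv {ι : Type*} (s : Finset ι) (f : ι → ℂ⟦X⟧) :
    (∏ i ∈ s, f i)⁻¹ = ∏ i ∈ s, (f i)⁻¹ := by
  classical
  induction s using Finset.induction_on with
  | empty => simp
  | insert i s hi ih =>
    rw [Finset.prod_insert hi, Finset.prod_insert hi, PowerSeries.mul_inv_rev, ih, mul_comm]

/-- If among any `k` consecutive factors one is divisible by `t`, then long products are divisible
by high powers of `t`. -/
theorem X_pow_dvd_prod {f : ℕ → ℂ⟦X⟧} {k : ℕ}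
    (hf : ∀ N, ∃ j < k, PowerSeries.X ∣ f (N + j)) (e : ℕ) {M : ℕ} (hM : e * k ≤ M) :
    PowerSeries.X ^ e ∣ ∏ j ∈ Finset.range M, f j := by
  induction e generalizing M with
  | zero => simp
  | succ e ih =>
    obtain ⟨r, rfl⟩ := Nat.exists_eq_add_of_le (show e * k ≤ M by rw [add_mul] at hM; omega)
    rw [Finset.prod_range_add, pow_succ]
    refine mul_dvd_mul (ih le_rfl) ?_
    obtain ⟨j, hj, hdvd⟩ := hf (e * k)
    exact hdvd.trans (Finset.dvd_prod_of_mem _ (Finset.mem_range.2 (by rw [add_mul] at hM; omega)))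

theorem exists_lt_dvd_add {k : ℕ} (hk : 0 < k) (s : ℕ) : ∃ j < k, k ∣ s + j + 1 := by
  refine ⟨k - 1 - s % k, by omega, s / k + 1, ?_⟩
  have h1 := Nat.div_add_mod s k
  have h2 := Nat.mod_lt s hk
  rw [mul_add]
  omega

/-- Among `k` consecutive exponents one is a multiple of `k`; there the constant term `1 - z ^ (i +
j + 1)` vanishes. This bounds the remainders in the functional equations. -/
theorem X_pow_dvd_prod_one_sub {z : ℂ} {k : ℕ} (hk : 0 < k) (hz : z ^ k = 1) {f : ℕ → ℂ⟦X⟧} {i : ℕ}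
    (hf : ∀ j, PowerSeries.constantCoeff (f j) = z ^ (i + j + 1)) (e : ℕ) {M : ℕ}
    (hM : e * k ≤ M) : PowerSeries.X ^ e ∣ ∏ j ∈ Finset.range M, (1 - f j) := by
  refine X_pow_dvd_prod (k := k) (fun N => ?_) e hM
  obtain ⟨j, hj, c, hc⟩ := exists_lt_dvd_add hk (i + N)
  refine ⟨j, hj, PowerSeries.X_dvd_iff.2 ?_⟩
  rw [map_sub, hf, map_one, ← add_assoc, hc, pow_mul, hz, one_pow, sub_self]

theorem coeff_eq_of_X_pow_dvd_sub {F G : ℂ⟦X⟧} {e m : ℕ} (h : PowerSeries.X ^ e ∣ F - G)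
    (hm : m < e) : PowerSeries.coeff m F = PowerSeries.coeff m G := by
  have := PowerSeries.X_pow_dvd_iff.1 h m hm
  rwa [map_sub, sub_eq_zero] at this

/-! ### Series at roots of unity and their expansions -/

theorem zetaPow_add (α x y : ℝ) : zetaPow α (x + y) = zetaPow α x * zetaPow α y := by
  rw [zetaPow, zetaPow, zetaPow, ← Complex.exp_add]
  congr 1
  push_cast
  ring

theorem zetaPow_natCast (α : ℝ) (n : ℕ) : zetaPow α n = zetaPow α 1 ^ n := by
  rw [zetaPow, zetaPow, ← Complex.exp_nat_mul]
  congr 1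
  push_cast
  ring

theorem qSer_eq (α : ℝ) : qSer α = PowerSeries.C (zetaPow α 1) * expSer (-1) := rfl

theorem qEighthSer_eq (α : ℝ) :
    qEighthSer α = PowerSeries.C (zetaPow α (1 / 8)) * expSer (-1 / 8) := rfl

theorem constantCoeff_qSer_pow (α : ℝ) (n : ℕ) :
    PowerSeries.constantCoeff (qSer α ^ n) = zetaPow α 1 ^ n := by
  rw [map_pow, qSer_eq, map_mul, constantCoeff_expSer, PowerSeries.constantCoeff_C, mul_one]

theorem hasExpansion_qFun (α : ℝ) : HasExpansion (qFun α) (qSer α) := by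
  have h := (HasExpansion.const (zetaPow α 1)).mul (HasExpansion.exp (-1))
  simp only [neg_mul, one_mul] at h
  exact h

theorem hasExpansion_qEighthFun (α : ℝ) : HasExpansion (qEighthFun α) (qEighthSer α) := by
  have h := (HasExpansion.const (zetaPow α (1 / 8))).mul (HasExpansion.exp (-1 / 8))
  have h2 : (fun t : ℝ => zetaPow α (1 / 8) * Complex.exp (-1 / 8 * t)) = qEighthFun α := by
    funext t
    rw [qEighthFun]
    congr 2
    ring
  rwa [h2] at h

theorem hasExpansion_H9Fun {α : ℝ} (h : ∀ j, 1 + zetaPow α 1 ^ j ≠ 0) (n : ℕ) :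
    HasExpansion (H9Fun α n) (H9Ser α n) := by
  have hq := hasExpansion_qFun α
  have h1 := HasExpansion.prod (Finset.range n) fun j => HasExpansion.one.sub (hq.pow (j + 1))
  have h2 := HasExpansion.prod (Finset.range n) fun j => HasExpansion.one.add (hq.pow (j + 1))
  refine (HasExpansion.const (-(1 / 4))).mul (h1.mul (h2.inv ?_))
  simp only [map_prod, map_add, map_one, constantCoeff_qSer_pow]
  exact Finset.prod_ne_zero_iff.2 fun j _ => h _

theorem hasExpansion_H10Fun {α : ℝ} (h : ∀ j, 1 - zetaPow α 1 ^ (2 * j + 1) ≠ 0) (n : ℕ) :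
    HasExpansion (H10Fun α n) (H10Ser α n) := by
  have hq := hasExpansion_qFun α
  have h1 := HasExpansion.prod (Finset.range n) fun j =>
    HasExpansion.one.sub (hq.pow (2 * (j + 1)))
  have h2 := HasExpansion.prod (Finset.range (n + 1)) fun j =>
    HasExpansion.one.sub (hq.pow (2 * j + 1))
  refine (HasExpansion.const (-2)).mul (((hasExpansion_qEighthFun α).mul h1).mul (h2.inv ?_))
  simp only [map_prod, map_sub, map_one, constantCoeff_qSer_pow]
  exact Finset.prod_ne_zero_iff.2 fun j _ => h _

/-- The power series `ζ ^ j e^{-(c w + s j) t}`. -/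
noncomputable def rootExp (z s c : ℂ) (j : ℕ) (w : ℂ) : ℂ⟦X⟧ :=
  PowerSeries.C (z ^ j) * expSer (-(c * w + s * j))

theorem isPolyFamily_rootExp (z s c : ℂ) (j : ℕ) : IsPolyFamily (rootExp z s c j) := by
  have h := IsPolyFamily.expSer (-(Polynomial.C c * Polynomial.X + Polynomial.C (s * j)))
  simp only [Polynomial.eval_neg, Polynomial.eval_add, Polynomial.eval_mul, Polynomial.eval_C,
    Polynomial.eval_X] at h
  exact (IsPolyFamily.const _).mul h

theorem constantCoeff_rootExp (z s c : ℂ) (j : ℕ) (w : ℂ) :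
    PowerSeries.constantCoeff (rootExp z s c j w) = z ^ j := by
  rw [rootExp, map_mul, constantCoeff_expSer, PowerSeries.constantCoeff_C, mul_one]

theorem rootExp_mul_pow (z s c : ℂ) (i j : ℕ) (w : ℂ) :
    rootExp z s c i w * (PowerSeries.C z * expSer (-s)) ^ j = rootExp z s c (i + j) w := by
  rw [rootExp, rootExp, mul_pow, expSer_pow, ← map_pow, mul_mul_mul_comm, ← map_mul, ← pow_add,
    expSer_mul]
  congr 2
  push_cast
  ring

/-- Since `z ^ k = 1`, moving the index by `k` changes only the exponential, and a shift of `w` has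
the same effect. This turns telescoping over `i` into a difference equation in `w`. -/
theorem rootExp_add_period {z s c : ℂ} {k : ℕ} (hz : z ^ k = 1) {u : ℂ} (hu : c * u = s * k)
    (j : ℕ) (w : ℂ) : rootExp z s c (j + k) w = rootExp z s c j (w + u) := by
  rw [rootExp, rootExp, pow_add, hz, mul_one]
  congr 2
  push_cast
  linear_combination hu

theorem rootExp_zero_zero (z s c : ℂ) : rootExp z s c 0 0 = 1 := by
  simp [rootExp, expSer_zero]

theorem hasFamilyDeriv_one_sub_rootExp (z s c : ℂ) :
    HasFamilyDeriv (fun w => 1 - rootExp z s c 0 w) (PowerSeries.C c * PowerSeries.X) := by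
  have hf : HasDerivAt (fun w : ℂ => -(c * w + s * (0 : ℕ))) (-c) 0 := by
    simpa using (((hasDerivAt_id (0 : ℂ)).const_mul c).add_const (s * (0 : ℕ))).fun_neg
  have h := (HasFamilyDeriv.const 1).sub (HasFamilyDeriv.expSer hf)
  simpa [rootExp, expSer_zero] using h

theorem hasFamilyDeriv_gaussian (c n : ℂ) :
    HasFamilyDeriv (fun w => expSer (-c * (n + w) ^ 2))
      (PowerSeries.C (-2 * c * n) * PowerSeries.X * expSer (-c * n ^ 2)) := by
  have hf : HasDerivAt (fun w : ℂ => -c * (n + w) ^ 2) (-2 * c * n) 0 := by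
    convert! (((hasDerivAt_id (0 : ℂ)).const_add n).fun_pow 2).const_mul (-c) using 1
    simp
    ring
  simpa using HasFamilyDeriv.expSer hf

theorem isPolyFamily_gaussian (c n : ℂ) : IsPolyFamily fun w => expSer (-c * (n + w) ^ 2) := by
  have h := IsPolyFamily.expSer (Polynomial.C (-c) * (Polynomial.C n + Polynomial.X) ^ 2)
  simpa only [Polynomial.eval_mul, Polynomial.eval_C, Polynomial.eval_pow, Polynomial.eval_add,
    Polynomial.eval_X] using h

theorem X_pow_dvd_telescope {V g : ℕ → ℂ⟦X⟧} {e : ℕ}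
    (hV : ∀ i, PowerSeries.X ^ e ∣ V i - V (i + 1) - g i) (h : ℕ) :
    PowerSeries.X ^ e ∣ V 0 - V h - ∑ i ∈ Finset.range h, g i := by
  rw [← Finset.sum_range_sub', ← Finset.sum_sub_distrib]
  exact Finset.dvd_sum fun i _ => hV i

/-! ### Odd order: the sum `H₉` -/

section OddOrder

/-- The partial sum of `∑ x ^ n (xq; q)_n / (-xq; q)_n` at `x = ζ ^ i e^{-(w + i) t}`,
`q = ζ e^{-t}`. -/
noncomputable def family9 (z : ℂ) (M i : ℕ) (w : ℂ) : ℂ⟦X⟧ :=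
  partialSum9 (rootExp z 1 1 i w) (PowerSeries.C z * expSer (-1))
    (fun j => (1 + rootExp z 1 1 (i + j + 1) w)⁻¹) M

variable {z : ℂ} {k : ℕ}

theorem isPolyFamily_family9 (z : ℂ) (M i : ℕ) : IsPolyFamily (family9 z M i) := by
  unfold family9 partialSum9
  refine IsPolyFamily.sum _ fun n => (((isPolyFamily_rootExp z 1 1 i).pow n).mul
    (IsPolyFamily.prod _ fun j => (IsPolyFamily.const 1).sub
      ((isPolyFamily_rootExp z 1 1 i).mul (IsPolyFamily.const _)))).mul
    (IsPolyFamily.prod _ fun j => ((IsPolyFamily.const 1).add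
      (isPolyFamily_rootExp z 1 1 (i + j + 1))).inv (c := 1 + z ^ (i + j + 1)) fun w => ?_)
  rw [map_add, map_one, constantCoeff_rootExp]

theorem family9_add_period (hz : z ^ k = 1) (M : ℕ) (w : ℂ) :
    family9 z M k w = family9 z M 0 (w + k) := by
  have hr : ∀ j, rootExp z 1 1 (j + k) w = rootExp z 1 1 j (w + k) := fun j =>
    rootExp_add_period hz (by ring) j w
  have h0 := hr 0
  rw [zero_add] at h0
  simp only [family9, h0]
  congr 1
  funext j
  rw [show k + j + 1 = 0 + j + 1 + k by ring, hr]

theorem family9_zero_zero (α : ℝ) (M : ℕ) :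
    ∑ n ∈ Finset.range M, H9Ser α n =
      PowerSeries.C (-(1 / 4)) * family9 (zetaPow α 1) M 0 0 := by
  rw [family9, partialSum9, Finset.mul_sum]
  refine Finset.sum_congr rfl fun n _ => ?_
  rw [H9Ser, strange9, powerSeries_prod_inv, rootExp_zero_zero, qSer_eq]
  simp only [one_pow, one_mul]
  congr 2
  refine Finset.prod_congr rfl fun j _ => ?_
  rw [add_assoc, ← rootExp_mul_pow, rootExp_zero_zero, one_mul]

theorem family9_add_shift (hz : ∀ j, 1 + z ^ j ≠ 0) (hk : 0 < k) (hzk : z ^ k = 1) {e M : ℕ}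
    (hM : e * k ≤ M) (i : ℕ) (w : ℂ) :
    ∃ T, PowerSeries.X ^ e ∣ T ∧ (1 - rootExp z 1 1 i w) * family9 z M i w +
        rootExp z 1 1 i w ^ 2 * (PowerSeries.C z * expSer (-1)) *
          ((1 - rootExp z 1 1 (i + 1) w) * family9 z M (i + 1) w) =
      1 - rootExp z 1 1 i w ^ 2 * (PowerSeries.C z * expSer (-1)) - T := by
  have h := partialSum9_add_shift (rootExp z 1 1 i w) (PowerSeries.C z * expSer (-1))
    (fun j => (1 + rootExp z 1 1 (i + j + 1) w)⁻¹) (fun j => by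
      rw [rootExp_mul_pow, ← add_assoc]
      refine PowerSeries.mul_inv_cancel _ ?_
      rw [map_add, map_one, constantCoeff_rootExp]
      exact hz _) M
  have h1 := rootExp_mul_pow z 1 1 i 1 w
  rw [pow_one] at h1
  have h2 : family9 z M (i + 1) w = partialSum9 (rootExp z 1 1 (i + 1) w)
      (PowerSeries.C z * expSer (-1)) (fun j => (1 + rootExp z 1 1 (i + (j + 1) + 1) w)⁻¹) M := by
    simp only [family9, add_assoc, add_comm 1]
  rw [h1, ← h2, ← family9] at h
  refine ⟨_, ?_, h⟩
  refine Dvd.dvd.mul_right (X_pow_dvd_prod_one_sub hk hzk (i := i) (fun j => ?_) e hM) _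
  rw [rootExp_mul_pow, constantCoeff_rootExp, add_assoc]

/-- The normalized theta family, whose coefficients solve a difference equation in `w`. -/
noncomputable def theta9 (z : ℂ) (M i : ℕ) (w : ℂ) : ℂ⟦X⟧ :=
  PowerSeries.C ((-z) ^ (i ^ 2)) * expSer (-1 * (i + w) ^ 2) *
    (PowerSeries.C (1 / 2) * ((1 - rootExp z 1 1 i w) * family9 z M i w + 1))

/-- Let `g_i` be the Gaussian with its coefficient. Then `g_{i+1} = -x² q g_i`, so the functional
equation makes `g_i (1 - x) S` drop by `g_i + g_{i+1}` at each step. Adding `g_i` changes this drop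
to `2 g_i`, which explains the summand `1` and the factor `1/2` in `theta9`. -/
theorem theta9_sub_succ (hz : ∀ j, 1 + z ^ j ≠ 0) (hk : 0 < k) (hzk : z ^ k = 1) {e M : ℕ}
    (hM : e * k ≤ M) (i : ℕ) (w : ℂ) :
    PowerSeries.X ^ e ∣ theta9 z M i w - theta9 z M (i + 1) w -
      PowerSeries.C ((-z) ^ (i ^ 2)) * expSer (-1 * (i + w) ^ 2) := by
  obtain ⟨T, hT, h⟩ := family9_add_shift hz hk hzk hM i w
  have hg : PowerSeries.C ((-z) ^ ((i + 1) ^ 2)) * expSer (-1 * ((i + 1 : ℕ) + w) ^ 2) =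
      -(PowerSeries.C ((-z) ^ (i ^ 2)) * expSer (-1 * (i + w) ^ 2) *
        (rootExp z 1 1 i w ^ 2 * (PowerSeries.C z * expSer (-1)))) := by
    have e1 : (-z) ^ ((i + 1) ^ 2) = -((-z) ^ (i ^ 2) * (z ^ i) ^ 2 * z) := by
      rw [show (i + 1) ^ 2 = i ^ 2 + (2 * i + 1) by ring, pow_add,
        Odd.neg_pow ⟨i, rfl⟩, ← pow_mul]
      ring
    have e2 : expSer (-1 * ((i + 1 : ℕ) + w) ^ 2) =
        expSer (-1 * (i + w) ^ 2) * expSer (-(1 * w + 1 * i)) ^ 2 * expSer (-1) := by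
      rw [expSer_pow, expSer_mul, expSer_mul]
      congr 1
      push_cast
      ring
    rw [e1, e2, rootExp, map_neg, map_mul, map_mul, map_pow _ (z ^ i)]
    ring
  have h2 : (PowerSeries.C (1 / 2 : ℂ)) * 2 = 1 := by
    rw [show (2 : ℂ⟦X⟧) = PowerSeries.C 2 from (map_ofNat PowerSeries.C 2).symm, ← map_mul]
    norm_num
  rw [theta9, theta9, hg]
  refine (hT.mul_left (-(PowerSeries.C ((-z) ^ (i ^ 2)) * expSer (-1 * (i + w) ^ 2) *
    PowerSeries.C (1 / 2)))).trans (dvd_of_eq ?_)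
  linear_combination -(PowerSeries.C ((-z) ^ (i ^ 2)) * expSer (-1 * (i + w) ^ 2)) *
    (PowerSeries.C (1 / 2) * h + h2)

theorem neg_pow_sq_antiperiodic (hk : Odd k) (hzk : z ^ k = 1) (n : ℕ) :
    (-z) ^ ((n + k) ^ 2) = -(-z) ^ (n ^ 2) := by
  rw [show (n + k) ^ 2 = n ^ 2 + k * (2 * n + k) by ring, pow_add, pow_mul, hk.neg_pow, hzk,
    Odd.neg_one_pow ((even_two_mul n).add_odd hk)]
  ring

theorem theta9_period (hk : Odd k) (hzk : z ^ k = 1) (M : ℕ) (w : ℂ) :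
    theta9 z M k w = -theta9 z M 0 (w + k) := by
  have h0 := rootExp_add_period (s := 1) (c := 1) hzk (u := k) (by ring) 0 w
  have h1 := neg_pow_sq_antiperiodic hk hzk 0
  rw [zero_add] at h0 h1
  rw [theta9, theta9, family9_add_period hzk, h0, h1]
  simp only [map_neg, Nat.cast_zero, zero_add, add_comm w]
  ring

theorem isFormalSum_H9Ser {α : ℝ} (hk : Odd k) (hz : ∀ j, 1 + zetaPow α 1 ^ j ≠ 0)
    (hzk : zetaPow α 1 ^ k = 1) {L : ℂ → ℂ} (hL : IsEntireContinuation (coeffL1 α) L) :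
    IsFormalSum (H9Ser α)
      (fun n => L (-2 * (n : ℂ) - 1) * (-1) ^ n / (n.factorial : ℂ)) := by
  intro m
  -- The remainder must be divisible by `t ^ (m + 2)`: the coefficient of `t ^ (m + 1)` is read off,
  -- because the derivative of `1 - x` contributes a factor `t`.
  filter_upwards [eventually_ge_atTop ((m + 2) * k)] with M hM
  rw [family9_zero_zero, PowerSeries.coeff_C_mul]
  set z := zetaPow α 1
  have hV : IsPolyFamily (theta9 z M 0) :=
    ((IsPolyFamily.const _).mul (isPolyFamily_gaussian _ _)).mul ((IsPolyFamily.const _).mul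
      ((((IsPolyFamily.const 1).sub (isPolyFamily_rootExp z 1 1 0)).mul
        (isPolyFamily_family9 z M 0)).add (IsPolyFamily.const 1)))
  obtain ⟨S', hS'⟩ := (isPolyFamily_family9 z M 0).exists_hasFamilyDeriv
  have hV' := ((HasFamilyDeriv.const (PowerSeries.C ((-z) ^ (0 ^ 2)))).mul
    (hasFamilyDeriv_gaussian 1 (0 : ℕ))).mul ((HasFamilyDeriv.const (PowerSeries.C (1 / 2))).mul
      (((hasFamilyDeriv_one_sub_rootExp z 1 1).mul hS').add (HasFamilyDeriv.const 1)))
  have key := coeff_familyDeriv_eq (m := m) (c := 1) hk.pos (neg_pow_sq_antiperiodic hk hzk) hL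
    hV hV' fun w => ?_
  -- At `w = 0` the Gaussian with `n = 0` is stationary and `1 - x` vanishes, so the derivative is
  -- `t S / 2`. Hence the `m`-th coefficient of `S` is `4 (-1) ^ (m + 1) L(-2m-1) / m!`, and the
  -- prefactor `-1/4` normalizes it.
  · simp only [rootExp_zero_zero] at key
    simp [expSer_zero] at key
    have e1 : (-1 : ℂ) ^ (m + 1) = -(-1) ^ m := by ring
    rw [e1] at key
    simp only [neg_mul]
    linear_combination -(1 / 2) * key
  · rw [← map_add]
    have h := X_pow_dvd_telescope (fun i => theta9_sub_succ hz hk.pos hzk hM i w) k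
    rw [theta9_period hk hzk, sub_neg_eq_add] at h
    exact coeff_eq_of_X_pow_dvd_sub h (by omega)

end OddOrder

/-! ### Even order `k = 2h`: the sum `H₁₀` -/

section EvenOrder

/-- The partial sum of `∑ x ^ n (xq²; q²)_n / (xq; q²)_{n + 1}` at `x = ζ ^ (2i) e^{-(w / 2 + 2i) t}`,
`q = ζ e^{-t}`. -/
noncomputable def family10 (z : ℂ) (M i : ℕ) (w : ℂ) : ℂ⟦X⟧ :=
  partialSum10 (rootExp (z ^ 2) 2 (1 / 2) i w) (PowerSeries.C z * expSer (-1))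
    (fun j => (1 - rootExp (z ^ 2) 2 (1 / 2) (i + j) w * (PowerSeries.C z * expSer (-1)))⁻¹) M

variable {z : ℂ} {h : ℕ}

theorem rootExp_sq_mul_pow (z : ℂ) (i j : ℕ) (w : ℂ) :
    rootExp (z ^ 2) 2 (1 / 2) i w * (PowerSeries.C z * expSer (-1)) ^ (2 * j) =
      rootExp (z ^ 2) 2 (1 / 2) (i + j) w := by
  rw [← rootExp_mul_pow, pow_mul, mul_pow, expSer_pow, ← map_pow]
  norm_num

theorem constantCoeff_rootExp_sq_mul (z : ℂ) (i : ℕ) (w : ℂ) :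
    PowerSeries.constantCoeff
      (rootExp (z ^ 2) 2 (1 / 2) i w * (PowerSeries.C z * expSer (-1))) = z ^ (2 * i + 1) := by
  rw [map_mul, constantCoeff_rootExp, map_mul, constantCoeff_expSer, PowerSeries.constantCoeff_C]
  ring

theorem isPolyFamily_family10 (z : ℂ) (M i : ℕ) : IsPolyFamily (family10 z M i) := by
  unfold family10 partialSum10
  refine IsPolyFamily.sum _ fun n => (((isPolyFamily_rootExp (z ^ 2) 2 (1 / 2) i).pow n).mul
    (IsPolyFamily.prod _ fun j => (IsPolyFamily.const 1).sub
      ((isPolyFamily_rootExp (z ^ 2) 2 (1 / 2) i).mul (IsPolyFamily.const _)))).mul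
    (IsPolyFamily.prod _ fun j => ((IsPolyFamily.const 1).sub
      ((isPolyFamily_rootExp (z ^ 2) 2 (1 / 2) (i + j)).mul (IsPolyFamily.const _))).inv
        (c := 1 - z ^ (2 * (i + j) + 1)) fun w => ?_)
  rw [map_sub, map_one, constantCoeff_rootExp_sq_mul]

theorem family10_add_period (hz : (z ^ 2) ^ h = 1) (M : ℕ) (w : ℂ) :
    family10 z M h w = family10 z M 0 (w + (4 * h : ℕ)) := by
  have hr : ∀ j, rootExp (z ^ 2) 2 (1 / 2) (j + h) w =
      rootExp (z ^ 2) 2 (1 / 2) j (w + (4 * h : ℕ)) := fun j =>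
    rootExp_add_period hz (by push_cast; ring) j w
  have h0 := hr 0
  rw [zero_add] at h0
  simp only [family10, h0]
  congr 1
  funext j
  rw [add_comm h, zero_add, hr]

theorem family10_zero_zero (α : ℝ) (M : ℕ) :
    ∑ n ∈ Finset.range M, H10Ser α n =
      PowerSeries.C (-2) * (qEighthSer α * family10 (zetaPow α 1) M 0 0) := by
  rw [family10, partialSum10, Finset.mul_sum, Finset.mul_sum]
  refine Finset.sum_congr rfl fun n _ => ?_
  rw [H10Ser, strange10, powerSeries_prod_inv, rootExp_zero_zero, qSer_eq]
  simp only [one_pow, one_mul]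
  rw [mul_assoc (qEighthSer α)]
  congr 3
  refine Finset.prod_congr rfl fun j _ => ?_
  rw [← rootExp_sq_mul_pow, rootExp_zero_zero, one_mul, pow_succ]

theorem family10_sub_shift (hz : ∀ j, 1 - z ^ (2 * j + 1) ≠ 0) (hh : 0 < h)
    (hzh : (z ^ 2) ^ h = 1) {e M : ℕ} (hM : e * h ≤ M) (i : ℕ) (w : ℂ) :
    ∃ T, PowerSeries.X ^ e ∣ T ∧ (1 - rootExp (z ^ 2) 2 (1 / 2) i w) * family10 z M i w -
        rootExp (z ^ 2) 2 (1 / 2) i w ^ 2 * (PowerSeries.C z * expSer (-1)) ^ 3 *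
          ((1 - rootExp (z ^ 2) 2 (1 / 2) (i + 1) w) * family10 z M (i + 1) w) =
      1 + rootExp (z ^ 2) 2 (1 / 2) i w * (PowerSeries.C z * expSer (-1)) - T := by
  have key := partialSum10_sub_shift (rootExp (z ^ 2) 2 (1 / 2) i w)
    (PowerSeries.C z * expSer (-1))
    (fun j => (1 - rootExp (z ^ 2) 2 (1 / 2) (i + j) w * (PowerSeries.C z * expSer (-1)))⁻¹)
    (fun j => by
      rw [pow_succ _ (2 * j), ← mul_assoc (rootExp _ _ _ i w), rootExp_sq_mul_pow]
      refine PowerSeries.mul_inv_cancel _ ?_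
      rw [map_sub, map_one, constantCoeff_rootExp_sq_mul]
      exact hz _) M
  have h1 := rootExp_sq_mul_pow z i 1 w
  rw [mul_one] at h1
  have h2 : family10 z M (i + 1) w = partialSum10 (rootExp (z ^ 2) 2 (1 / 2) (i + 1) w)
      (PowerSeries.C z * expSer (-1)) (fun j =>
        (1 - rootExp (z ^ 2) 2 (1 / 2) (i + (j + 1)) w * (PowerSeries.C z * expSer (-1)))⁻¹) M := by
    simp only [family10, add_assoc, add_comm 1]
  rw [h1, ← h2, ← family10] at key
  refine ⟨_, ?_, key⟩
  refine Dvd.dvd.mul_right (X_pow_dvd_prod_one_sub hh hzh (i := i) (fun j => ?_) e hM) _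
  rw [rootExp_sq_mul_pow, constantCoeff_rootExp, add_assoc]

/-- The coefficients `ζ ^ (n² / 8)` for odd `n`, and `0` for even `n`. -/
noncomputable def oddCoeff (α : ℝ) (n : ℕ) : ℂ :=
  if Odd n then zetaPow α ((n : ℝ) ^ 2 / 8) else 0

theorem oddCoeff_of_odd (α : ℝ) {n : ℕ} (hn : Odd n) :
    oddCoeff α n = zetaPow α ((n : ℝ) ^ 2 / 8) := if_pos hn

theorem oddCoeff_of_even (α : ℝ) {n : ℕ} (hn : Even n) : oddCoeff α n = 0 :=
  if_neg (Nat.not_odd_iff_even.2 hn)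

/-- The index `0` is a genuine exception, as `J(2 | 0) = 1`. Dirichlet series ignore that index, but
antiperiodicity needs the value `0` there, hence the separate `oddCoeff`. -/
theorem coeffL2_eq_oddCoeff (α : ℝ) {n : ℕ} (hn : n ≠ 0) : coeffL2 α n = oddCoeff α n := by
  rcases Nat.even_or_odd n with he | ho
  · rw [oddCoeff_of_even α he, coeffL2, jacobiSym.eq_zero_iff.2 ⟨hn, fun hg => ?_⟩]
    · simp
    · have : 2 ∣ Int.gcd 2 n := Int.dvd_gcd (by norm_num) (by exact_mod_cast he.two_dvd)
      omega
  · rw [oddCoeff_of_odd α ho, coeffL2]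
    have h1 : J(2 | n) ^ 2 = 1 := jacobiSym.sq_one (by
      exact_mod_cast Nat.coprime_two_left.2 ho)
    rw [← Int.cast_pow, h1, Int.cast_one, one_mul]

theorem isEntireContinuation_coeffL2_iff (α : ℝ) (L : ℂ → ℂ) :
    IsEntireContinuation (coeffL2 α) L ↔ IsEntireContinuation (oddCoeff α) L := by
  refine and_congr_right fun _ => forall₂_congr fun s _ => ?_
  exact LSeriesHasSum_congr s (L s) fun hn => coeffL2_eq_oddCoeff α hn

/-- Adding `r` to the index multiplies the coefficient by an integral power of `ζ`. -/
theorem oddCoeff_add {α : ℝ} {n r s : ℕ} (hn : Odd n) (hr : Even r) (hs : 2 * n * r + r ^ 2 = 8 * s) :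
    oddCoeff α (n + r) = oddCoeff α n * zetaPow α 1 ^ s := by
  rw [oddCoeff_of_odd α hn, oddCoeff_of_odd α (hn.add_even hr), ← zetaPow_natCast, ← zetaPow_add]
  congr 1
  have : (2 * n * r + r ^ 2 : ℝ) = 8 * s := by exact_mod_cast hs
  push_cast
  linear_combination this / 8

/-- For odd `n`, `((n + 4h)² - n²) / 8 = h (n + 2h)`, so the coefficient is multiplied by `(-1) ^ (n
+ 2h) = -1`. -/
theorem oddCoeff_antiperiodic {α : ℝ} (hz : zetaPow α 1 ^ h = -1) (n : ℕ) :
    oddCoeff α (n + 4 * h) = -oddCoeff α n := by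
  have h4 : Even (4 * h) := ⟨2 * h, by ring⟩
  rcases Nat.even_or_odd n with he | ho
  · rw [oddCoeff_of_even α he, oddCoeff_of_even α (he.add h4), neg_zero]
  · rw [oddCoeff_add ho h4 (s := h * (n + 2 * h)) (by ring), pow_mul, hz,
      (ho.add_even (even_two_mul h)).neg_one_pow]
    ring

/-- The normalized theta family, whose coefficients solve a difference equation in `w`. -/
noncomputable def theta10 (α : ℝ) (M i : ℕ) (w : ℂ) : ℂ⟦X⟧ :=
  PowerSeries.C (oddCoeff α (4 * i + 1)) * expSer (-(1 / 8) * ((4 * i + 1 : ℕ) + w) ^ 2) *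
    ((1 - rootExp (zetaPow α 1 ^ 2) 2 (1 / 2) i w) * family10 (zetaPow α 1) M i w)

/-- The Gaussians at `4i + 3` and `4i + 5` are those at `4i + 1` times `xq` and `x² q³`. The right
side `1 + xq` of the functional equation thus yields the two odd indices in a block of four, and `x²
q³` carries the family to the next block. -/
theorem theta10_sub_succ {α : ℝ} (hz : ∀ j, 1 - zetaPow α 1 ^ (2 * j + 1) ≠ 0) (hh : 0 < h)
    (hzh : (zetaPow α 1 ^ 2) ^ h = 1) {e M : ℕ} (hM : e * h ≤ M) (i : ℕ) (w : ℂ) :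
    PowerSeries.X ^ e ∣ theta10 α M i w - theta10 α M (i + 1) w -
      (PowerSeries.C (oddCoeff α (4 * i + 1)) * expSer (-(1 / 8) * ((4 * i + 1 : ℕ) + w) ^ 2) +
        PowerSeries.C (oddCoeff α (4 * i + 3)) *
          expSer (-(1 / 8) * ((4 * i + 3 : ℕ) + w) ^ 2)) := by
  obtain ⟨T, hT, key⟩ := family10_sub_shift hz hh hzh hM i w
  have ho : Odd (4 * i + 1) := ⟨2 * i, by ring⟩
  have hg3 : PowerSeries.C (oddCoeff α (4 * i + 3)) *
        expSer (-(1 / 8) * ((4 * i + 3 : ℕ) + w) ^ 2) =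
      PowerSeries.C (oddCoeff α (4 * i + 1)) * expSer (-(1 / 8) * ((4 * i + 1 : ℕ) + w) ^ 2) *
        (rootExp (zetaPow α 1 ^ 2) 2 (1 / 2) i w *
          (PowerSeries.C (zetaPow α 1) * expSer (-1))) := by
    have e2 : expSer (-(1 / 8) * ((4 * i + 3 : ℕ) + w) ^ 2) =
        expSer (-(1 / 8) * ((4 * i + 1 : ℕ) + w) ^ 2) * expSer (-(1 / 2 * w + 2 * i)) *
          expSer (-1) := by
      rw [expSer_mul, expSer_mul]
      congr 1
      push_cast
      ring
    rw [e2, show 4 * i + 3 = 4 * i + 1 + 2 by ring,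
      oddCoeff_add ho even_two (s := 2 * i + 1) (by ring), rootExp, map_mul, pow_succ, pow_mul,
      map_mul]
    ring
  have hg5 : PowerSeries.C (oddCoeff α (4 * (i + 1) + 1)) *
        expSer (-(1 / 8) * ((4 * (i + 1) + 1 : ℕ) + w) ^ 2) =
      PowerSeries.C (oddCoeff α (4 * i + 1)) * expSer (-(1 / 8) * ((4 * i + 1 : ℕ) + w) ^ 2) *
        (rootExp (zetaPow α 1 ^ 2) 2 (1 / 2) i w ^ 2 *
          (PowerSeries.C (zetaPow α 1) * expSer (-1)) ^ 3) := by
    have e2 : expSer (-(1 / 8) * ((4 * (i + 1) + 1 : ℕ) + w) ^ 2) =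
        expSer (-(1 / 8) * ((4 * i + 1 : ℕ) + w) ^ 2) * expSer (-(1 / 2 * w + 2 * i)) ^ 2 *
          expSer (-1) ^ 3 := by
      rw [expSer_pow, expSer_pow, expSer_mul, expSer_mul]
      congr 1
      push_cast
      ring
    rw [e2, show 4 * (i + 1) + 1 = 4 * i + 1 + 4 by ring,
      oddCoeff_add ho ⟨2, rfl⟩ (s := 2 * i * 2 + 3) (by ring), rootExp, map_mul, pow_add, pow_mul,
      pow_mul, map_mul, map_pow, map_pow _ _ 3]
    ring
  rw [theta10, theta10, hg3, hg5]
  refine (hT.mul_left (-(PowerSeries.C (oddCoeff α (4 * i + 1)) *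
    expSer (-(1 / 8) * ((4 * i + 1 : ℕ) + w) ^ 2)))).trans (dvd_of_eq ?_)
  linear_combination -(PowerSeries.C (oddCoeff α (4 * i + 1)) *
    expSer (-(1 / 8) * ((4 * i + 1 : ℕ) + w) ^ 2)) * key

theorem theta10_period {α : ℝ} (hz : zetaPow α 1 ^ h = -1) (M : ℕ) (w : ℂ) :
    theta10 α M h w = -theta10 α M 0 (w + (4 * h : ℕ)) := by
  have hzh : (zetaPow α 1 ^ 2) ^ h = 1 := by rw [← pow_mul, mul_comm, pow_mul, hz]; norm_num
  have h0 := rootExp_add_period (s := 2) (c := 1 / 2) hzh (u := (4 * h : ℕ))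
    (by push_cast; ring) 0 w
  rw [zero_add] at h0
  rw [theta10, theta10, family10_add_period hzh, h0, add_comm (4 * h) 1,
    oddCoeff_antiperiodic hz, map_neg, mul_zero, zero_add,
    show ((1 + 4 * h : ℕ) + w : ℂ) = (1 : ℕ) + (w + (4 * h : ℕ)) by push_cast; ring]
  ring

theorem sum_range_four_mul {M : Type*} [AddCommMonoid M] (f : ℕ → M) (hf : ∀ n, Even n → f n = 0)
    (h : ℕ) :
    ∑ n ∈ Finset.range (4 * h), f n = ∑ i ∈ Finset.range h, (f (4 * i + 1) + f (4 * i + 3)) := by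
  induction h with
  | zero => simp
  | succ h ih =>
    rw [show 4 * (h + 1) = 4 * h + 1 + 1 + 1 + 1 by ring, Finset.sum_range_succ,
      Finset.sum_range_succ, Finset.sum_range_succ, Finset.sum_range_succ, ih,
      Finset.sum_range_succ, hf (4 * h) ⟨2 * h, by ring⟩, hf (4 * h + 1 + 1) ⟨2 * h + 1, by ring⟩,
      add_zero, add_zero, add_assoc]

theorem isFormalSum_H10Ser {α : ℝ} (hh : 0 < h) (hz : ∀ j, 1 - zetaPow α 1 ^ (2 * j + 1) ≠ 0)
    (hzh : zetaPow α 1 ^ h = -1) {L : ℂ → ℂ} (hL : IsEntireContinuation (coeffL2 α) L) :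
    IsFormalSum (H10Ser α)
      (fun n => L (-2 * (n : ℂ) - 1) * (-1) ^ n / (8 ^ n * (n.factorial : ℂ))) := by
  intro m
  -- Here `h` replaces `k`, since the numerator factors involve powers of `ζ²`, and `(ζ²) ^ h = 1`.
  filter_upwards [eventually_ge_atTop ((m + 2) * h)] with M hM
  have hzh2 : (zetaPow α 1 ^ 2) ^ h = 1 := by rw [← pow_mul, mul_comm, pow_mul, hzh]; norm_num
  rw [family10_zero_zero, PowerSeries.coeff_C_mul]
  have hV : IsPolyFamily (theta10 α M 0) :=
    ((IsPolyFamily.const _).mul (isPolyFamily_gaussian _ _)).mul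
      (((IsPolyFamily.const 1).sub (isPolyFamily_rootExp _ 2 (1 / 2) 0)).mul
        (isPolyFamily_family10 _ M 0))
  obtain ⟨S', hS'⟩ := (isPolyFamily_family10 (zetaPow α 1) M 0).exists_hasFamilyDeriv
  have hV' := ((HasFamilyDeriv.const (PowerSeries.C (oddCoeff α (4 * 0 + 1)))).mul
    (hasFamilyDeriv_gaussian (1 / 8) (4 * 0 + 1 : ℕ))).mul
      ((hasFamilyDeriv_one_sub_rootExp (zetaPow α 1 ^ 2) 2 (1 / 2)).mul hS')
  have key := coeff_familyDeriv_eq (m := m) (c := 1 / 8) (K := 4 * h) (by positivity)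
    (oddCoeff_antiperiodic hzh) ((isEntireContinuation_coeffL2_iff α L).1 hL) hV hV' fun w => ?_
  -- The factor `q ^ (1/8)` of `H₁₀` is the Gaussian term with `n = 1` at `w = 0`. The derivative of
  -- that Gaussian drops out, being multiplied by `1 - x = 0`.
  · have hq : qEighthSer α = PowerSeries.C (oddCoeff α (4 * 0 + 1)) *
        expSer (-(1 / 8) * ((4 * 0 + 1 : ℕ) + 0) ^ 2) := by
      rw [qEighthSer_eq, oddCoeff_of_odd α (n := 4 * 0 + 1) ⟨0, rfl⟩]
      norm_num
    rw [← hq] at key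
    simp only [rootExp_zero_zero, sub_self, zero_mul, mul_zero, zero_add, add_zero] at key
    rw [show qEighthSer α * (PowerSeries.C (1 / 2) * PowerSeries.X * family10 (zetaPow α 1) M 0 0) =
      PowerSeries.C (1 / 2) * (PowerSeries.X * (qEighthSer α * family10 (zetaPow α 1) M 0 0)) by ring,
      PowerSeries.coeff_C_mul, PowerSeries.coeff_succ_X_mul] at key
    rw [show (-(1 / 8) : ℂ) = -1 / 8 by ring, div_pow, pow_succ, pow_succ] at key
    have h1 : (m.factorial : ℂ) ≠ 0 := by exact_mod_cast m.factorial_ne_zero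
    -- The `1/2` comes from the derivative of `1 - x`, as `x = e^{-wt/2}` at `i = 0`; the constants
    -- combine to `-4 · 2 · (-1/8) ^ (m + 1) = (-1/8) ^ m`.
    rw [show ∀ y : ℂ, -2 * y = -4 * (1 / 2 * y) by intro y; ring, key]
    field_simp
    ring
  · rw [← map_add]
    have ht := X_pow_dvd_telescope (fun i => theta10_sub_succ hz hh hzh2 hM i w) h
    rw [theta10_period hzh, sub_neg_eq_add, ← sum_range_four_mul (fun n =>
      PowerSeries.C (oddCoeff α n) * expSer (-(1 / 8) * (n + w) ^ 2)) (fun n hn => by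
        rw [oddCoeff_of_even α hn, map_zero, zero_mul])] at ht
    exact coeff_eq_of_X_pow_dvd_sub ht (by omega)

end EvenOrder

/-! ### The two parities -/

theorem corollary1p1 (k : ℕ) (hk : 0 < k) (α : ℝ) (hζ : IsPrimitiveRoot (zetaPow α 1) k) :
    (Odd k →
      (∃ L₁ : ℂ → ℂ, IsEntireContinuation (coeffL1 α) L₁) ∧
      ∀ L₁ : ℂ → ℂ, IsEntireContinuation (coeffL1 α) L₁ →
        IsFormalSum (H9Ser α)
          (fun n => L₁ (-2 * (n : ℂ) - 1) * (-1) ^ n / (n.factorial : ℂ)) ∧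
        HasStrangeAsymptotics (H9Fun α)
          (fun n => L₁ (-2 * (n : ℂ) - 1) * (-1) ^ n / (n.factorial : ℂ))) ∧
    (Even k →
      (∃ L₂ : ℂ → ℂ, IsEntireContinuation (coeffL2 α) L₂) ∧
      ∀ L₂ : ℂ → ℂ, IsEntireContinuation (coeffL2 α) L₂ →
        IsFormalSum (H10Ser α)
          (fun n => L₂ (-2 * (n : ℂ) - 1) * (-1) ^ n / (8 ^ n * (n.factorial : ℂ))) ∧
        HasStrangeAsymptotics (H10Fun α)
          (fun n => L₂ (-2 * (n : ℂ) - 1) * (-1) ^ n / (8 ^ n * (n.factorial : ℂ)))) := by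
  refine ⟨fun hodd => ?_, fun heven => ?_⟩
  -- For odd `k`, `-1` is not a `k`-th root of unity, so the denominators of `H₉` are invertible.
  · have hz : ∀ j, 1 + zetaPow α 1 ^ j ≠ 0 := fun j hj => by
      have h1 : (zetaPow α 1 ^ j) ^ k = 1 := by rw [← pow_mul, mul_comm, pow_mul, hζ.pow_eq_one, one_pow]
      rw [show zetaPow α 1 ^ j = -1 by linear_combination hj, hodd.neg_one_pow] at h1
      norm_num at h1
    have : NeZero (2 * k) := ⟨by positivity⟩
    refine ⟨⟨_, isEntireContinuation_LFunction (K := k)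
      (neg_pow_sq_antiperiodic hodd hζ.pow_eq_one)⟩, fun L hL => ?_⟩
    have h := isFormalSum_H9Ser hodd hz hζ.pow_eq_one hL
    exact ⟨h, h.hasStrangeAsymptotics (hasExpansion_H9Fun hz)⟩
  -- An even `k` cannot divide an odd exponent, so the denominators of `H₁₀` are invertible.
  · have hz : ∀ j, 1 - zetaPow α 1 ^ (2 * j + 1) ≠ 0 := fun j hj => by
      have h1 := heven.two_dvd.trans ((hζ.pow_eq_one_iff_dvd _).1 (sub_eq_zero.1 hj).symm)
      omega
    obtain ⟨h, rfl⟩ := heven.two_dvd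
    have hh : 0 < h := by omega
    have hzh : zetaPow α 1 ^ h = -1 := by
      have h2 : (zetaPow α 1 ^ h) ^ 2 = 1 := by rw [← pow_mul, mul_comm, hζ.pow_eq_one]
      exact (mul_self_eq_one_iff.1 (by rw [← sq, h2])).resolve_left
        (hζ.pow_ne_one_of_pos_of_lt hh.ne' (by omega))
    have : NeZero (2 * (4 * h)) := ⟨by positivity⟩
    refine ⟨⟨_, (isEntireContinuation_coeffL2_iff α _).2
      (isEntireContinuation_LFunction (oddCoeff_antiperiodic hzh))⟩, fun L hL => ?_⟩
    have hf := isFormalSum_H10Ser hh hz hzh hL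
    exact ⟨hf, hf.hasStrangeAsymptotics (hasExpansion_H10Fun hz)⟩
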